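/- Let $M$ be a smooth Banach manifold modelled on a real Banach space $E$, with an affine connection $B\colon TM\oplus TM\to TTM$. In each smooth chart $\varphi\colon U\to V\subseteq E$ it is given by a smooth map $B^\varphi$ from $V$ into the space of continuous bilinear maps $E\times E\to E$, and for two charts, with transition map $h=\varphi_2\circ\varphi_1^{-1}$, $$B^{\varphi_2}_{h(x)}(dh(x)v,dh(x)w)=d^2h(x)(v,w)+dh(x)\bigl(B^{\varphi_1}_x(v,w)\bigr).$$ A geodesic is a smooth curve $\alpha$ on an interval which in every chart satisfies $(\varphi\circ\alpha)''(t)=B^\varphi_{\varphi(\alpha(t))}\bigl((\varphi\circ\alpha)'(t),(\varphi\circ\alpha)'(t)\bigr)$. A piecewise geodesic is a continuous curve $\alpha\colon[a,b]\to M$ for which there are $a=t_0\le t_1\le\dots\le t_n=b$ such that each restriction $\alpha|_{[t_{i-1},t_i]}$ is a geodesic. Homotopies between curves with common endpoints are understood to keep the endpoints fixed. Let $\alpha_0,\alpha_1\colon[0,1]\to M$ be piecewise geodesics with $\alpha_0(0)=\alpha_1(0)$ and $\alpha_0(1)=\alpha_1(1)$. (1) If $\alpha_0$ and $\alpha_1$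 are homotopic, then there is a homotopy $H\colon[0,1]\times[0,1]\to M$ from $H(\cdot,0)=\alpha_0$ to $H(\cdot,1)=\alpha_1$ such that each curve $\alpha_s:=H(\cdot,s)$, $s\in[0,1]$, is a piecewise geodesic. (2) If $M$ is simply connected, i.e. every loop in $M$ is homotopic to a constant loop ($M$ need not be connected), then for any such $\alpha_0,\alpha_1$ there is a homotopy $H$ from $\alpha_0$ to $\alpha_1$ such that each curve $H(\cdot,s)$, $s\in[0,1]$, is a piecewise geodesic. -/

import Mathlib

open scoped Manifold ContDiff unitInterval

noncomputable section

/-- An affine connection `B : TM ⊕ TM → TTM` on a smooth manifold `M` modelled on `E`, given by its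
local representations.  In a chart `φ : U → V ⊆ E` the connection reads
`(x, v, w) ↦ (x, v, w, B^φ_x(v, w))` with `B^φ` a smooth map from `V` into the space of continuous
bilinear maps `E × E → E`; here `B^φ` is `localRep φ`.  A family of such maps, one for each chart of
the smooth structure, comes from a (unique) connection exactly when it obeys the transformation law
`transform`, in which `h` is the transition map `φ₂ ∘ φ₁⁻¹`.
The values of `localRep φ` off the target of `φ`, or for a `φ` which is not a smooth chart, are
never used. -/
structure AffineConnection (E : Type*) [NormedAddCommGroup E] [NormedSpace ℝ E]
    (M : Type*) [TopologicalSpace M] [ChartedSpace E M] where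
  localRep : OpenPartialHomeomorph M E → E → E →L[ℝ] E →L[ℝ] E
  smooth : ∀ φ ∈ IsManifold.maximalAtlas 𝓘(ℝ, E) ∞ M, ContDiffOn ℝ ∞ (localRep φ) φ.target
  transform : ∀ φ₁ ∈ IsManifold.maximalAtlas 𝓘(ℝ, E) ∞ M,
    ∀ φ₂ ∈ IsManifold.maximalAtlas 𝓘(ℝ, E) ∞ M, ∀ h : E → E, h = φ₂ ∘ φ₁.symm →
      ∀ x ∈ (φ₁.symm.trans φ₂).source, ∀ v w : E,
        localRep φ₂ (h x) (fderiv ℝ h x v) (fderiv ℝ h x w) =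
          fderiv ℝ (fderiv ℝ h) x v w + fderiv ℝ h x (localRep φ₁ x v w)

namespace AffineConnection

variable {E : Type*} [NormedAddCommGroup E] [NormedSpace ℝ E]
  {M : Type*} [TopologicalSpace M] [ChartedSpace E M]

/-- The expression in the chart `φ` of the derivative along the curve `α` of a lift `γ` of `α` to
the tangent bundle: `(∇_{α'} γ)^φ (t) = (γ^φ)'(t) - B^φ_{α^φ(t)} (γ^φ(t), (α^φ)'(t))`.  Here `J` is
the interval of definition, `a = α^φ` and `g = γ^φ`. -/
def covDerivAlong (B : AffineConnection E M) (φ : OpenPartialHomeomorph M E) (J : Set ℝ)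
    (a g : ℝ → E) (t : ℝ) : E :=
  derivWithin g J t - B.localRep φ (a t) (g t) (derivWithin a J t)

/-- The curve `α`, restricted to the interval `J`, is a geodesic: it is smooth and
`∇_{α'} α' = 0`. -/
def IsGeodesicOn (B : AffineConnection E M) (α : ℝ → M) (J : Set ℝ) : Prop :=
  ContMDiffOn 𝓘(ℝ, ℝ) 𝓘(ℝ, E) ∞ α J ∧
    ∀ φ ∈ IsManifold.maximalAtlas 𝓘(ℝ, E) ∞ M, ∀ t ∈ J, α t ∈ φ.source →
      B.covDerivAlong φ J (φ ∘ α) (derivWithin (φ ∘ α) J) t = 0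

/-- The curve `α`, restricted to `[a, b]`, is a piecewise geodesic: it is continuous and there are
`a = t₀ ≤ t₁ ≤ ⋯ ≤ tₙ = b` such that `α` is a geodesic on each `[tᵢ₋₁, tᵢ]`. -/
def IsPiecewiseGeodesicOn (B : AffineConnection E M) (α : ℝ → M) (a b : ℝ) : Prop :=
  ContinuousOn α (Set.Icc a b) ∧
    ∃ (n : ℕ) (t : Fin (n + 1) → ℝ), t 0 = a ∧ t (Fin.last n) = b ∧ Monotone t ∧
      ∀ i : Fin n, B.IsGeodesicOn α (Set.Icc (t i.castSucc) (t i.succ))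

/-- A path `[0, 1] → M` is a piecewise geodesic. -/
def IsPiecewiseGeodesic (B : AffineConnection E M) {x y : M} (α : Path x y) : Prop :=
  B.IsPiecewiseGeodesicOn α.extend 0 1

end AffineConnection

end

/-! Everything rests on a local boundary value problem. In a chart near a point, `u'' = f u u' u'`
with `u 0 = x`, `u 1 = y` is solved by Banach's fixed point theorem for the velocity `u'`
(`GeodesicBVP.exists_solution`). Each point thus has a neighbourhood `U` with geodesics `c x y` from
`x` to `y`, continuous in all variables and constant for `x = y` (`exists_connectsBy`).

Inside `U`, a piecewise geodesic is shortened to a single geodesic by replacing longer and longer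
initial pieces with `c`. Two piecewise geodesics in `U` are therefore deformed into each other by
shortening the first, moving the end points of the resulting geodesic, and undoing the shortening of
the second (`ConnectsBy.geodesicallyHomotopic`). Because the motion of the end points can be
prescribed, such deformations glue along a subdivision: all piecewise geodesics whose graphs are
close to that of a given curve are deformable into each other (`exists_nhds_geodesicallyHomotopic`),
and every curve has piecewise geodesics arbitrarily close to it
(`exists_isPiecewiseGeodesicOn_mem`).

Connectedness of the parameter interval of a given homotopy turns this local statement into (1). For
(2), a contractible loop `α₀ · α₁⁻¹` makes `α₀` and `α₁` homotopic. -/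

open Set Filter Topology Relation

/-! ### Geodesics in charts; restriction and gluing of piecewise geodesics. -/

namespace AffineConnection

section Geodesics

variable {E : Type*} [NormedAddCommGroup E] [NormedSpace ℝ E]
  {M : Type*} [TopologicalSpace M] [ChartedSpace E M]
  {B : AffineConnection E M} {α β : ℝ → M} {a b c : ℝ}

theorem IsGeodesicOn.congr {J : Set ℝ} (h : B.IsGeodesicOn α J) (hαβ : EqOn α β J) :
    B.IsGeodesicOn β J := by
  refine ⟨h.1.congr fun t ht => (hαβ ht).symm, fun φ hφ t ht hs => ?_⟩
  have h0 : EqOn (φ ∘ β) (φ ∘ α) J := fun τ hτ => by simp [hαβ hτ]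
  have h1 : EqOn (derivWithin (φ ∘ β) J) (derivWithin (φ ∘ α) J) J := fun τ hτ =>
    derivWithin_congr h0 (h0 hτ)
  have h2 := h.2 φ hφ t ht (by rwa [hαβ ht])
  unfold covDerivAlong at h2 ⊢
  rwa [derivWithin_congr h1 (h1 ht), h0 ht, h1 ht]

theorem IsGeodesicOn.continuousOn {J : Set ℝ} (h : B.IsGeodesicOn α J) : ContinuousOn α J :=
  h.1.continuousOn

/-- The local expression of a smooth curve in a chart is smooth. -/
theorem contDiffWithinAt_chart_comp [IsManifold 𝓘(ℝ, E) ∞ M] {J : Set ℝ}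
    (h : ContMDiffOn 𝓘(ℝ, ℝ) 𝓘(ℝ, E) ∞ α J)
    {φ : OpenPartialHomeomorph M E} (hφ : φ ∈ IsManifold.maximalAtlas 𝓘(ℝ, E) ∞ M) {t : ℝ}
    (ht : t ∈ J) (hs : α t ∈ φ.source) : ContDiffWithinAt ℝ ∞ (φ ∘ α) J t := by
  rw [← contMDiffWithinAt_iff_contDiffWithinAt]
  exact (contMDiffAt_of_mem_maximalAtlas hφ hs).comp_contMDiffWithinAt t (h t ht)

/-- The derivatives in the definition are taken within the interval. They survive restriction
because a nondegenerate subinterval has unique derivatives, hence the strict inequality. -/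
theorem IsGeodesicOn.mono [IsManifold 𝓘(ℝ, E) ∞ M] {a' b' : ℝ}
    (h : B.IsGeodesicOn α (Icc a b)) (hab : a' < b') (ha : a ≤ a') (hb : b' ≤ b) :
    B.IsGeodesicOn α (Icc a' b') := by
  have hsub : Icc a' b' ⊆ Icc a b := Icc_subset_Icc ha hb
  have hU' := uniqueDiffOn_Icc hab
  have hU := uniqueDiffOn_Icc (ha.trans_lt (hab.trans_le hb))
  refine ⟨h.1.mono hsub, fun φ hφ t ht hs => ?_⟩
  have key : ∀ τ ∈ Icc a' b', α τ ∈ φ.source →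
      derivWithin (φ ∘ α) (Icc a' b') τ = derivWithin (φ ∘ α) (Icc a b) τ := fun τ hτ hτs =>
    derivWithin_subset hsub (hU' τ hτ)
      ((contDiffWithinAt_chart_comp h.1 hφ (hsub hτ) hτs).differentiableWithinAt (by simp))
  have hev : derivWithin (φ ∘ α) (Icc a' b') =ᶠ[𝓝[Icc a' b'] t]
      derivWithin (φ ∘ α) (Icc a b) := by
    have := (h.1.continuousOn.mono hsub) t ht (φ.open_source.mem_nhds hs)
    filter_upwards [this, self_mem_nhdsWithin] with τ h1 h2 using key τ h2 h1
  have hd : DifferentiableWithinAt ℝ (derivWithin (φ ∘ α) (Icc a b)) (Icc a b) t :=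
    (((contDiffWithinAt_chart_comp h.1 hφ (hsub ht) hs).fderivWithin_right hU
      (m := 1) (by norm_cast) (hsub ht)).clm_apply contDiffWithinAt_const).differentiableWithinAt
      (by simp)
  have h2 := h.2 φ hφ t (hsub ht) hs
  unfold covDerivAlong at h2 ⊢
  rw [hev.derivWithin_eq (key t ht hs), derivWithin_subset hsub (hU' t ht) hd, key t ht hs]
  exact h2

/-- A curve which solves the geodesic equation in one chart is a geodesic. -/
theorem isGeodesicOn_symm_comp [CompleteSpace E] [IsManifold 𝓘(ℝ, E) ∞ M] (B : AffineConnection E M)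
    {φ : OpenPartialHomeomorph M E}
    (hφ : φ ∈ IsManifold.maximalAtlas 𝓘(ℝ, E) ∞ M) (hab : a < b) {u w : ℝ → E}
    (hu : ∀ t ∈ Icc a b, HasDerivWithinAt u (w t) (Icc a b) t)
    (hw : ∀ t ∈ Icc a b, HasDerivWithinAt w (B.localRep φ (u t) (w t) (w t)) (Icc a b) t)
    (hmem : ∀ t ∈ Icc a b, u t ∈ φ.target) :
    B.IsGeodesicOn (φ.symm ∘ u) (Icc a b) := by
  have hU := uniqueDiffOn_Icc hab
  have hucont : ContinuousOn u (Icc a b) := fun t ht => (hu t ht).continuousWithinAt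
  -- Smoothness is a bootstrap: `(u, w)` solves a first order system with smooth right-hand side.
  have hsm : ContDiffOn ℝ ∞ u (Icc a b) := by
    have hz : ∀ t ∈ Icc a b, HasDerivWithinAt (fun t => (u t, w t))
        ((fun _ (z : E × E) => (z.2, B.localRep φ z.1 z.2 z.2)) t (u t, w t)) (Icc a b) t :=
      fun t ht => (hu t ht).prodMk (hw t ht)
    have hf : ContDiffOn ℝ ∞ (Function.uncurry
        (fun (_ : ℝ) (z : E × E) => (z.2, B.localRep φ z.1 z.2 z.2)))
        (Icc a b ×ˢ (φ.target ×ˢ univ)) := by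
      have h1 : ContDiffOn ℝ ∞ (fun q : ℝ × E × E => B.localRep φ q.2.1)
          (Icc a b ×ˢ (φ.target ×ˢ univ)) :=
        (B.smooth φ hφ).comp (by fun_prop) (fun q hq => hq.2.1)
      have h2 : ContDiffOn ℝ ∞ (fun q : ℝ × E × E => q.2.2)
          (Icc a b ×ˢ (φ.target ×ˢ univ)) := by fun_prop
      exact h2.prodMk ((h1.clm_apply h2).clm_apply h2)
    have := ODE.contDiffOn_enat_Icc_of_hasDerivWithinAt (n := ⊤) hf hz
      (fun t ht => ⟨hmem t ht, mem_univ _⟩)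
    exact (this.of_le (by simp)).fst
  have hα : ContMDiffOn 𝓘(ℝ, ℝ) 𝓘(ℝ, E) ∞ (φ.symm ∘ u) (Icc a b) :=
    (contMDiffOn_symm_of_mem_maximalAtlas hφ).comp hsm.contMDiffOn hmem
  refine ⟨hα, fun φ₂ hφ₂ t ht hs => ?_⟩
  set h : E → E := φ₂ ∘ φ.symm with hh
  set S := (φ.symm.trans φ₂).source with hS
  have hSo : IsOpen S := (φ.symm.trans φ₂).open_source
  have hhS : ContDiffOn ℝ ∞ h S := by
    rw [← contMDiffOn_iff_contDiffOn]
    refine (contMDiffOn_of_mem_maximalAtlas hφ₂).comp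
      ((contMDiffOn_symm_of_mem_maximalAtlas hφ).mono ?_) ?_
    · intro z hz; simpa using hz.1
    · intro z hz; simpa using hz.2
  have htS : u t ∈ S := by
    simp only [hS, OpenPartialHomeomorph.trans_source, OpenPartialHomeomorph.symm_source]
    exact ⟨hmem t ht, hs⟩
  have hdiff : ∀ z ∈ S, HasFDerivAt h (fderiv ℝ h z) z := fun z hz =>
    ((hhS.contDiffAt (hSo.mem_nhds hz)).differentiableAt (by simp)).hasFDerivAt
  have hdiff2 : HasFDerivAt (fderiv ℝ h) (fderiv ℝ (fderiv ℝ h) (u t)) (u t) :=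
    (((hhS.contDiffAt (hSo.mem_nhds htS)).fderiv_right (m := 1) (by norm_cast)).differentiableAt
      (by simp)).hasFDerivAt
  have key : ∀ τ ∈ Icc a b, u τ ∈ S →
      derivWithin (φ₂ ∘ φ.symm ∘ u) (Icc a b) τ = fderiv ℝ h (u τ) (w τ) := fun τ hτ hτS =>
    ((hdiff _ hτS).comp_hasDerivWithinAt τ (hu τ hτ)).derivWithin (hU τ hτ)
  have hev : derivWithin (φ₂ ∘ φ.symm ∘ u) (Icc a b) =ᶠ[𝓝[Icc a b] t]
      fun τ => fderiv ℝ h (u τ) (w τ) := by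
    filter_upwards [hucont t ht (hSo.mem_nhds htS), self_mem_nhdsWithin] with τ h1 h2
      using key τ h2 h1
  -- By the chain rule the second derivative in the chart `φ₂` is the right-hand side of the
  -- transformation law with `v = w`, so the geodesic equation passes to every other chart.
  have hd : HasDerivWithinAt (fun τ => fderiv ℝ h (u τ) (w τ))
      (fderiv ℝ (fderiv ℝ h) (u t) (w t) (w t) +
        fderiv ℝ h (u t) (B.localRep φ (u t) (w t) (w t))) (Icc a b) t :=
    (hdiff2.comp_hasDerivWithinAt t (hu t ht)).clm_apply (hw t ht)
  unfold covDerivAlong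
  rw [hev.derivWithin_eq (key t ht htS), hd.derivWithin (hU t ht), key t ht htS,
    ← B.transform φ hφ φ₂ hφ₂ h hh (u t) htS, sub_eq_zero]
  rfl

/-- `a` is joined to `b` by finitely many successive intervals on which `α` is a geodesic. -/
def GeodesicChain (B : AffineConnection E M) (α : ℝ → M) : ℝ → ℝ → Prop :=
  ReflTransGen fun u v => u ≤ v ∧ B.IsGeodesicOn α (Icc u v)

theorem GeodesicChain.le (h : B.GeodesicChain α a b) : a ≤ b := by
  induction h with
  | refl => exact le_rfl
  | tail _ h ih => exact ih.trans h.1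

theorem GeodesicChain.congr (h : B.GeodesicChain α a b) (hαβ : EqOn α β (Icc a b)) :
    B.GeodesicChain β a b := by
  induction h with
  | refl => exact ReflTransGen.refl
  | @tail v w hv hw ih =>
    have hav := GeodesicChain.le hv
    exact (ih (hαβ.mono (Icc_subset_Icc_right hw.1))).tail
      ⟨hw.1, hw.2.congr (hαβ.mono (Icc_subset_Icc_left hav))⟩

theorem GeodesicChain.mono [IsManifold 𝓘(ℝ, E) ∞ M] (h : B.GeodesicChain α a b) :
    ∀ {a' b' : ℝ}, a ≤ a' → a' ≤ b' → b' ≤ b → B.GeodesicChain α a' b' := by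
  induction h with
  | refl =>
    intro a' b' h1 h2 h3
    obtain rfl : a' = b' := le_antisymm h2 (h3.trans h1)
    exact ReflTransGen.refl
  | @tail v w hv hw ih =>
    intro a' b' h1 h2 h3
    rcases h2.eq_or_lt with rfl | h2
    · exact ReflTransGen.refl
    rcases le_or_gt b' v with h4 | h4
    · exact ih h1 h2.le h4
    rcases le_or_gt a' v with h5 | h5
    · exact (ih h1 h5 le_rfl).tail ⟨h4.le, hw.2.mono h4 le_rfl h3⟩
    · exact ReflTransGen.single ⟨h2.le, hw.2.mono h2 h5.le h3⟩

/-- With chains in place of indexed subdivisions, concatenation is transitivity and restriction is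
an induction on the last link. -/
theorem isPiecewiseGeodesicOn_iff :
    B.IsPiecewiseGeodesicOn α a b ↔ ContinuousOn α (Icc a b) ∧ B.GeodesicChain α a b := by
  refine and_congr_right fun hα => ⟨?_, fun h => ?_⟩
  · rintro ⟨n, t, rfl, rfl, ht, hg⟩
    have : ∀ i : Fin (n + 1), B.GeodesicChain α (t 0) (t i) := by
      intro i
      induction i using Fin.induction with
      | zero => exact ReflTransGen.refl
      | succ i ih => exact ih.tail ⟨ht i.castSucc_lt_succ.le, hg i⟩
    exact this _
  · clear hα
    induction h with
    | refl => exact ⟨0, fun _ => a, rfl, rfl, monotone_const, fun i => i.elim0⟩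
    | @tail v w _ hw ih =>
      obtain ⟨n, t, h0, hl, ht, hg⟩ := ih
      refine ⟨n + 1, Fin.snoc t w, ?_, Fin.snoc_last _ _, ?_, ?_⟩
      · rw [← Fin.castSucc_zero, Fin.snoc_castSucc, h0]
      · refine Fin.monotone_iff_le_succ.2 fun i => ?_
        induction i using Fin.lastCases with
        | last => rw [Fin.snoc_castSucc, Fin.succ_last, Fin.snoc_last, hl]; exact hw.1
        | cast i =>
          rw [Fin.snoc_castSucc, Fin.succ_castSucc, Fin.snoc_castSucc]
          exact ht i.castSucc_lt_succ.le
      · intro i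
        induction i using Fin.lastCases with
        | last => rw [Fin.snoc_castSucc, Fin.succ_last, Fin.snoc_last, hl]; exact hw.2
        | cast i =>
          rw [Fin.snoc_castSucc, Fin.succ_castSucc, Fin.snoc_castSucc]
          exact hg i

theorem IsGeodesicOn.isPiecewiseGeodesicOn (hab : a ≤ b) (h : B.IsGeodesicOn α (Icc a b)) :
    B.IsPiecewiseGeodesicOn α a b :=
  isPiecewiseGeodesicOn_iff.2 ⟨h.continuousOn, ReflTransGen.single ⟨hab, h⟩⟩

theorem IsPiecewiseGeodesicOn.congr (h : B.IsPiecewiseGeodesicOn α a b)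
    (hαβ : EqOn α β (Icc a b)) : B.IsPiecewiseGeodesicOn β a b := by
  rw [isPiecewiseGeodesicOn_iff] at h ⊢
  exact ⟨h.1.congr hαβ.symm, h.2.congr hαβ⟩

theorem IsPiecewiseGeodesicOn.mono [IsManifold 𝓘(ℝ, E) ∞ M] {a' b' : ℝ}
    (h : B.IsPiecewiseGeodesicOn α a b) (ha : a ≤ a') (hab : a' ≤ b') (hb : b' ≤ b) :
    B.IsPiecewiseGeodesicOn α a' b' := by
  rw [isPiecewiseGeodesicOn_iff] at h ⊢
  exact ⟨h.1.mono (Icc_subset_Icc ha hb), h.2.mono ha hab hb⟩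

theorem IsPiecewiseGeodesicOn.trans (h₁ : B.IsPiecewiseGeodesicOn α a b)
    (h₂ : B.IsPiecewiseGeodesicOn α b c) : B.IsPiecewiseGeodesicOn α a c := by
  rw [isPiecewiseGeodesicOn_iff] at h₁ h₂ ⊢
  refine ⟨?_, ReflTransGen.trans h₁.2 h₂.2⟩
  rw [← Icc_union_Icc_eq_Icc h₁.2.le h₂.2.le]
  exact h₁.1.union_of_isClosed h₂.1 isClosed_Icc isClosed_Icc

/-- Two piecewise geodesics with a common end point can be glued. -/
theorem IsPiecewiseGeodesicOn.ite (h₁ : B.IsPiecewiseGeodesicOn α a b)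
    (h₂ : B.IsPiecewiseGeodesicOn β b c) (hb : α b = β b) :
    B.IsPiecewiseGeodesicOn (fun t => if t ≤ b then α t else β t) a c := by
  refine (h₁.congr fun t ht => (if_pos ht.2).symm).trans (h₂.congr fun t ht => ?_)
  rcases ht.1.eq_or_lt with rfl | h
  · simp [hb]
  · simp [h.not_ge]

end Geodesics

end AffineConnection

/-! ### The boundary value problem for geodesics in a Banach space. -/

namespace GeodesicBVP

section BoundaryValueProblem

variable {E : Type*} [NormedAddCommGroup E] [NormedSpace ℝ E]

/-- The primitive of `w` vanishing at `0`. -/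
noncomputable def prim (w : C(I, E)) (t : ℝ) : E :=
  ∫ s in (0 : ℝ)..t, IccExtend zero_le_one w s

omit [NormedSpace ℝ E] in
theorem continuous_extend (w : C(I, E)) : Continuous (IccExtend (zero_le_one' ℝ) w) :=
  w.continuous.Icc_extend'

theorem hasDerivAt_prim [CompleteSpace E] (w : C(I, E)) (t : ℝ) :
    HasDerivAt (prim w) (IccExtend zero_le_one w t) t :=
  ((continuous_extend w).integral_hasStrictDerivAt 0 t).hasDerivAt

theorem prim_zero (w : C(I, E)) : prim w 0 = 0 := intervalIntegral.integral_same

theorem prim_sub (w w' : C(I, E)) (t : ℝ) : prim w t - prim w' t = prim (w - w') t := by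
  unfold prim
  rw [← intervalIntegral.integral_sub ((continuous_extend w).intervalIntegrable _ _)
    ((continuous_extend w').intervalIntegrable _ _)]
  rfl

theorem norm_prim_le (w : C(I, E)) {t : ℝ} (ht : t ∈ I) : ‖prim w t‖ ≤ ‖w‖ := by
  have := intervalIntegral.norm_integral_le_of_norm_le_const (a := 0) (b := t)
    (f := IccExtend (zero_le_one' ℝ) w) (C := ‖w‖) fun s _ => w.norm_coe_le_norm _
  refine this.trans ?_
  rw [sub_zero, abs_of_nonneg ht.1]
  exact mul_le_of_le_one_right (norm_nonneg _) ht.2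

theorem continuous_prim [CompleteSpace E] (w : C(I, E)) : Continuous (prim w) :=
  continuous_iff_continuousAt.2 fun t => (hasDerivAt_prim w t).continuousAt

theorem prim_const [CompleteSpace E] (v : E) (t : ℝ) : prim (ContinuousMap.const I v) t = t • v := by
  unfold prim
  have : (IccExtend (zero_le_one' ℝ) (ContinuousMap.const I v)) = fun _ => v := rfl
  rw [this]
  simp

/-- The primitive as a continuous function on the unit interval. -/
noncomputable def primC [CompleteSpace E] (w : C(I, E)) : C(I, E) :=
  ⟨fun t => prim w t, (continuous_prim w).comp continuous_subtype_val⟩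

theorem norm_primC_sub_le [CompleteSpace E] (w w' : C(I, E)) :
    ‖primC w - primC w'‖ ≤ ‖w - w'‖ := by
  refine (ContinuousMap.norm_le _ (norm_nonneg _)).2 fun t => ?_
  change ‖prim w t - prim w' t‖ ≤ _
  rw [prim_sub]
  exact norm_prim_le _ t.2

open Classical in
/-- The acceleration prescribed by `f` for the curve from `x` with velocity `w`, when continuous. -/
noncomputable def accel (f : E → E →L[ℝ] E →L[ℝ] E) (x : E) (w : C(I, E)) : C(I, E) :=
  if h : Continuous fun t : I => f (x + prim w t) (w t) (w t) then ⟨_, h⟩ else 0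

/-- The map on velocities whose fixed points solve `u'' = f u u' u'`, `u 0 = x`, `u 1 = y`. -/
noncomputable def velocityMap [CompleteSpace E] (f : E → E →L[ℝ] E →L[ℝ] E) (x y : E)
    (w : C(I, E)) : C(I, E) :=
  ContinuousMap.const I (y - x) + primC (accel f x w) -
    ContinuousMap.const I (prim (primC (accel f x w)) 1)

variable {f : E → E →L[ℝ] E →L[ℝ] E} {p : E} {R L C : ℝ} {x x' y y' : E} {w w' : C(I, E)}

theorem add_prim_mem (hx : x ∈ Metric.ball p (R / 4)) (hw : ‖w‖ ≤ R) {t : ℝ} (ht : t ∈ I) :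
    x + prim w t ∈ Metric.ball p (2 * R) := by
  rw [Metric.mem_ball, dist_eq_norm] at hx ⊢
  have h1 := norm_prim_le w ht
  have h2 := norm_add_le (x - p) (prim w t)
  have h3 : x + prim w t - p = (x - p) + prim w t := by abel
  rw [h3]
  linarith [norm_nonneg w]

theorem accel_apply [CompleteSpace E] (hf : ContinuousOn f (Metric.ball p (2 * R)))
    (hx : x ∈ Metric.ball p (R / 4)) (hw : ‖w‖ ≤ R) (t : I) :
    accel f x w t = f (x + prim w t) (w t) (w t) := by
  have h : Continuous fun t : I => f (x + prim w t) (w t) (w t) := by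
    have h1 : Continuous fun t : I => f (x + prim w t) :=
      hf.comp_continuous (continuous_const.add ((continuous_prim w).comp continuous_subtype_val))
        fun t => add_prim_mem hx hw t.2
    exact (h1.clm_apply w.continuous).clm_apply w.continuous
  rw [accel, dif_pos h]
  rfl

theorem norm_accel_sub_le [CompleteSpace E] (hC : ∀ z ∈ Metric.ball p (2 * R), ‖f z‖ ≤ C)
    (hL : ∀ z ∈ Metric.ball p (2 * R), ∀ z' ∈ Metric.ball p (2 * R), ‖f z - f z'‖ ≤ L * ‖z - z'‖)
    (hf : ContinuousOn f (Metric.ball p (2 * R))) (hL0 : 0 ≤ L) (hC0 : 0 ≤ C)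
    (hx : x ∈ Metric.ball p (R / 4)) (hx' : x' ∈ Metric.ball p (R / 4))
    (hw : ‖w‖ ≤ R) (hw' : ‖w'‖ ≤ R) :
    ‖accel f x w - accel f x' w'‖ ≤
      L * (‖x - x'‖ + ‖w - w'‖) * R * R + 2 * (C * R) * ‖w - w'‖ := by
  have hR : 0 ≤ R := (norm_nonneg w).trans hw
  refine (ContinuousMap.norm_le _ (by positivity)).2 fun t => ?_
  rw [ContinuousMap.sub_apply, accel_apply hf hx hw, accel_apply hf hx' hw']
  set z := x + prim w t with hz
  set z' := x' + prim w' t with hz'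
  have hzm : z ∈ Metric.ball p (2 * R) := add_prim_mem hx hw t.2
  have hzm' : z' ∈ Metric.ball p (2 * R) := add_prim_mem hx' hw' t.2
  have h1 : ‖w t‖ ≤ R := (w.norm_coe_le_norm t).trans hw
  have h1' : ‖w' t‖ ≤ R := (w'.norm_coe_le_norm t).trans hw'
  have h2 : ‖w t - w' t‖ ≤ ‖w - w'‖ := (w - w').norm_coe_le_norm t
  have h3 : ‖z - z'‖ ≤ ‖x - x'‖ + ‖w - w'‖ := by
    have : z - z' = (x - x') + prim (w - w') t := by rw [hz, hz', ← prim_sub]; abel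
    rw [this]
    exact (norm_add_le _ _).trans (add_le_add le_rfl (norm_prim_le _ t.2))
  -- The first term is controlled by the Lipschitz constant `L`, the other two by the bound `C`,
  -- using `‖w‖, ‖w'‖ ≤ R`.
  have e : f z (w t) (w t) - f z' (w' t) (w' t) =
      (f z - f z') (w t) (w t) + (f z' (w t - w' t) (w t) + f z' (w' t) (w t - w' t)) := by
    simp only [map_sub, sub_apply]
    abel
  have b1 : ‖(f z - f z') (w t) (w t)‖ ≤ L * (‖x - x'‖ + ‖w - w'‖) * R * R :=
    ((f z - f z').le_opNorm₂ _ _).trans <| by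
      have := hL z hzm z' hzm'
      gcongr
      exact this.trans (by gcongr)
  have b2 : ‖f z' (w t - w' t) (w t)‖ ≤ C * ‖w - w'‖ * R :=
    ((f z').le_opNorm₂ _ _).trans <| by
      have := hC z' hzm'
      gcongr
  have b3 : ‖f z' (w' t) (w t - w' t)‖ ≤ C * R * ‖w - w'‖ :=
    ((f z').le_opNorm₂ _ _).trans <| by
      have := hC z' hzm'
      gcongr
  rw [e]
  refine (norm_add_le _ _).trans ?_
  have := norm_add_le (f z' (w t - w' t) (w t)) (f z' (w' t) (w t - w' t))
  linarith

/-- The acceleration varies by at most a quarter of the variation of its data; it enters once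
through its primitive and once through the mean of that primitive, whence the factors `1 / 2`.
Letting `x`, `y` and `w` vary together gives at once the contraction, the invariance of the ball and
the dependence on the end points. -/
theorem norm_velocityMap_sub_le [CompleteSpace E]
    (hC : ∀ z ∈ Metric.ball p (2 * R), ‖f z‖ ≤ C)
    (hL : ∀ z ∈ Metric.ball p (2 * R), ∀ z' ∈ Metric.ball p (2 * R), ‖f z - f z'‖ ≤ L * ‖z - z'‖)
    (hf : ContinuousOn f (Metric.ball p (2 * R))) (hL0 : 0 ≤ L) (hC0 : 0 ≤ C)
    (hsmall : L * R * R + 2 * (C * R) ≤ 1 / 4)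
    (hx : x ∈ Metric.ball p (R / 4)) (hx' : x' ∈ Metric.ball p (R / 4))
    (hw : ‖w‖ ≤ R) (hw' : ‖w'‖ ≤ R) :
    ‖velocityMap f x y w - velocityMap f x' y' w'‖ ≤
      ‖(y - x) - (y' - x')‖ + 1 / 2 * ‖x - x'‖ + 1 / 2 * ‖w - w'‖ := by
  have hR : 0 ≤ R := (norm_nonneg w).trans hw
  have hN := norm_accel_sub_le hC hL hf hL0 hC0 hx hx' hw hw'
  have hN' : ‖accel f x w - accel f x' w'‖ ≤ 1 / 4 * ‖x - x'‖ + 1 / 4 * ‖w - w'‖ := by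
    have h1 : 0 ≤ (1 / 4 - (L * R * R + 2 * (C * R))) * ‖w - w'‖ :=
      mul_nonneg (by linarith) (norm_nonneg _)
    have h2 : 0 ≤ (1 / 4 - L * R * R) * ‖x - x'‖ :=
      mul_nonneg (by linarith [mul_nonneg hC0 hR]) (norm_nonneg _)
    linarith
  refine (ContinuousMap.norm_le _ (by positivity)).2 fun t => ?_
  have e : (velocityMap f x y w - velocityMap f x' y' w') t =
      ((y - x) - (y' - x')) + ((primC (accel f x w) - primC (accel f x' w')) t -
        prim (primC (accel f x w) - primC (accel f x' w')) 1) := by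
    rw [← prim_sub]
    simp only [velocityMap, ContinuousMap.sub_apply, ContinuousMap.add_apply,
      ContinuousMap.const_apply]
    abel
  have h0 := norm_primC_sub_le (accel f x w) (accel f x' w')
  have h1 := (primC (accel f x w) - primC (accel f x' w')).norm_coe_le_norm t
  have h2 := norm_prim_le (primC (accel f x w) - primC (accel f x' w')) (t := 1) (by simp)
  rw [e]
  refine (norm_add_le _ _).trans ?_
  have h3 := norm_sub_le ((primC (accel f x w) - primC (accel f x' w')) t)
    (prim (primC (accel f x w) - primC (accel f x' w')) 1)
  linarith

/-- The constant curve is the reference solution: comparison with it bounds `velocityMap` and shows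
that the solution for `x = y` is constant. -/
theorem velocityMap_self_zero [CompleteSpace E] (f : E → E →L[ℝ] E →L[ℝ] E) (x : E) :
    velocityMap f x x 0 = 0 := by
  have h0 : ∀ t, prim (0 : C(I, E)) t = 0 := fun t => by
    have := prim_const (0 : E) t
    rwa [smul_zero] at this
  have h1 : accel f x 0 = 0 := by
    unfold accel
    split_ifs
    · ext t; simp
    · rfl
  have h2 : primC (0 : C(I, E)) = 0 := by ext t; exact h0 t
  ext t
  simp [velocityMap, h1, h2, h0]

theorem exists_fixedPoint_velocityMap [CompleteSpace E]
    (hC : ∀ z ∈ Metric.ball p (2 * R), ‖f z‖ ≤ C)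
    (hL : ∀ z ∈ Metric.ball p (2 * R), ∀ z' ∈ Metric.ball p (2 * R), ‖f z - f z'‖ ≤ L * ‖z - z'‖)
    (hf : ContinuousOn f (Metric.ball p (2 * R))) (hL0 : 0 ≤ L) (hC0 : 0 ≤ C) (hR : 0 ≤ R)
    (hsmall : L * R * R + 2 * (C * R) ≤ 1 / 4)
    (hx : x ∈ Metric.ball p (R / 4)) (hy : y ∈ Metric.ball p (R / 4)) :
    ∃ w : C(I, E), ‖w‖ ≤ R ∧ velocityMap f x y w = w := by
  have hmaps : MapsTo (velocityMap f x y) (Metric.closedBall 0 R) (Metric.closedBall 0 R) := by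
    intro w hw
    rw [mem_closedBall_zero_iff] at hw ⊢
    have := norm_velocityMap_sub_le (y := y) (y' := x) hC hL hf hL0 hC0 hsmall hx hx hw
      (w' := 0) (by simpa using hR)
    rw [velocityMap_self_zero] at this
    -- What remains is `‖velocityMap f x y w‖ ≤ ‖y - x‖ + ‖w‖ / 2`, and `‖y - x‖ < R / 2` since both
    -- points are within `R / 4` of `p`.
    simp only [sub_self, sub_zero, norm_zero, mul_zero, add_zero] at this
    rw [Metric.mem_ball, dist_eq_norm] at hx hy
    have h2 : y - x = (y - p) - (x - p) := by abel
    have h3 := norm_sub_le (y - p) (x - p)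
    rw [← h2] at h3
    linarith
  have hcontr : ContractingWith (1 / 2 : NNReal)
      (hmaps.restrict (velocityMap f x y) (Metric.closedBall 0 R) (Metric.closedBall 0 R)) := by
    refine ⟨by rw [← NNReal.coe_lt_coe]; norm_num, LipschitzWith.of_dist_le_mul fun w w' => ?_⟩
    have := norm_velocityMap_sub_le (y := y) (y' := y) hC hL hf hL0 hC0 hsmall hx hx
      (mem_closedBall_zero_iff.1 w.2) (mem_closedBall_zero_iff.1 w'.2)
    rw [Subtype.dist_eq, Subtype.dist_eq, dist_eq_norm, dist_eq_norm]
    simpa using this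
  obtain ⟨w, hw, hfix, -⟩ := hcontr.exists_fixedPoint' Metric.isClosed_closedBall.isComplete
    hmaps (x := 0) (by simpa using hR) (edist_ne_top _ _)
  exact ⟨w, mem_closedBall_zero_iff.1 hw, hfix⟩

/-- Near `p`, the boundary value problem `u'' = f u u' u'`, `u 0 = x`, `u 1 = y` has a solution
which depends continuously on `x` and `y` and is constant if `x = y`. -/
theorem exists_solution [CompleteSpace E] {V : Set E} (hV : IsOpen V) (hfV : ContDiffOn ℝ ∞ f V)
    (hp : p ∈ V) :
    ∃ r > 0, ∃ u w : E → E → ℝ → E,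
      (∀ x ∈ Metric.ball p r, ∀ y ∈ Metric.ball p r,
        (∀ t ∈ I, HasDerivWithinAt (u x y) (w x y t) I t) ∧
        (∀ t ∈ I, HasDerivWithinAt (w x y) (f (u x y t) (w x y t) (w x y t)) I t) ∧
        (∀ t ∈ I, u x y t ∈ V) ∧ u x y 0 = x ∧ u x y 1 = y) ∧
      (∀ x ∈ Metric.ball p r, ∀ t, u x x t = x) ∧
      ContinuousOn (fun q : E × E × ℝ => u q.1 q.2.1 q.2.2)
        (Metric.ball p r ×ˢ Metric.ball p r ×ˢ I) ∧ Metric.ball p r ⊆ V := by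
  have hfp : ContDiffAt ℝ 1 f p := (hfV.contDiffAt (hV.mem_nhds hp)).of_le (by norm_cast)
  obtain ⟨K, t, ht, hK⟩ := hfp.exists_lipschitzOnWith
  have hn : ContinuousAt (fun z => ‖f z‖) p :=
    (continuous_norm (E := E →L[ℝ] E →L[ℝ] E)).continuousAt.comp hfp.continuousAt
  have hbd : ∀ᶠ z in 𝓝 p, ‖f z‖ < ‖f p‖ + 1 :=
    hn.tendsto.eventually_lt_const (lt_add_one _)
  obtain ⟨ρ, hρ, hball⟩ := Metric.mem_nhds_iff.1
    (inter_mem (inter_mem ht hbd) (hV.mem_nhds hp))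
  let L : ℝ := (K : ℝ)
  let C : ℝ := ‖f p‖ + 1
  have hL0 : 0 ≤ L := K.2
  have hC0 : 0 ≤ C := by positivity
  -- `ρ / 2` keeps the ball of radius `2 * R` where `f` is controlled; `1` allows `R * R ≤ R`; the
  -- last term then yields `hsmall`.
  let R : ℝ := min (ρ / 2) (min 1 (1 / (4 * (L + 2 * C + 1))))
  have hR : 0 < R := by positivity
  have hR1 : R ≤ ρ / 2 := min_le_left _ _
  have hR2 : R ≤ 1 := (min_le_right _ _).trans (min_le_left _ _)
  have hR3 : R * (4 * (L + 2 * C + 1)) ≤ 1 := by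
    have : R ≤ 1 / (4 * (L + 2 * C + 1)) := (min_le_right _ _).trans (min_le_right _ _)
    rwa [le_div_iff₀ (by positivity)] at this
  have hsmall : L * R * R + 2 * (C * R) ≤ 1 / 4 := by
    have : L * R * R ≤ L * R * 1 := by gcongr
    linarith
  have hsub : Metric.ball p (2 * R) ⊆ (t ∩ {z | ‖f z‖ < ‖f p‖ + 1}) ∩ V :=
    (Metric.ball_subset_ball (by linarith)).trans hball
  have hf : ContinuousOn f (Metric.ball p (2 * R)) :=
    hfV.continuousOn.mono fun z hz => (hsub hz).2
  have hC : ∀ z ∈ Metric.ball p (2 * R), ‖f z‖ ≤ C := fun z hz => le_of_lt (hsub hz).1.2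
  have hL : ∀ z ∈ Metric.ball p (2 * R), ∀ z' ∈ Metric.ball p (2 * R),
      ‖f z - f z'‖ ≤ L * ‖z - z'‖ := fun z hz z' hz' =>
    hK.norm_sub_le (hsub hz).1.1 (hsub hz').1.1
  have hex : ∀ x y, x ∈ Metric.ball p (R / 4) → y ∈ Metric.ball p (R / 4) →
      ∃ w : C(I, E), ‖w‖ ≤ R ∧ velocityMap f x y w = w := fun x y hx hy =>
    exists_fixedPoint_velocityMap hC hL hf hL0 hC0 hR.le hsmall hx hy
  choose! W hWR hW using hex
  -- For two fixed points, the term `1 / 2 * ‖W x y - W x' y'‖` is absorbed into the left-hand side.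
  have hlip : ∀ x ∈ Metric.ball p (R / 4), ∀ y ∈ Metric.ball p (R / 4),
      ∀ x' ∈ Metric.ball p (R / 4), ∀ y' ∈ Metric.ball p (R / 4),
      ‖W x y - W x' y'‖ ≤ 2 * ‖(y - x) - (y' - x')‖ + ‖x - x'‖ := by
    intro x hx y hy x' hx' y' hy'
    have := norm_velocityMap_sub_le (y := y) (y' := y') hC hL hf hL0 hC0 hsmall hx hx'
      (hWR x y hx hy) (hWR x' y' hx' hy')
    rw [hW x y hx hy, hW x' y' hx' hy'] at this
    linarith
  have hW0 : ∀ x ∈ Metric.ball p (R / 4), W x x = 0 := by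
    intro x hx
    have := norm_velocityMap_sub_le (y := x) (y' := x) hC hL hf hL0 hC0 hsmall hx hx
      (hWR x x hx hx) (w' := 0) (by simpa using hR.le)
    rw [hW x x hx hx, velocityMap_self_zero] at this
    simp only [sub_self, sub_zero, norm_zero, mul_zero, add_zero, zero_add] at this
    exact norm_le_zero_iff.1 (by linarith)
  have hprim0 : ∀ t, prim (0 : C(I, E)) t = 0 := fun t => by
    have := prim_const (0 : E) t
    rwa [smul_zero] at this
  refine ⟨R / 4, by positivity, fun x y t => x + prim (W x y) t,
    fun x y t => IccExtend zero_le_one (W x y) t, ?_, ?_, ?_, ?_⟩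
  · intro x hx y hy
    have hfix := hW x y hx hy
    set N := accel f x (W x y) with hN
    have hval : ∀ t : I, W x y t = (y - x) + prim N t - prim (primC N) 1 := fun t => by
      conv_lhs => rw [← hfix]
      rfl
    have hval' : ∀ t ∈ I, IccExtend (zero_le_one' ℝ) (W x y) t =
        (y - x) + prim N t - prim (primC N) 1 := fun t ht => by
      rw [IccExtend_of_mem _ _ ht]
      exact hval ⟨t, ht⟩
    refine ⟨fun t ht => ?_, fun t ht => ?_, fun t ht => ?_, ?_, ?_⟩
    · exact ((hasDerivAt_prim (W x y) t).const_add x).hasDerivWithinAt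
    · have h1 : HasDerivWithinAt (fun t => (y - x) + prim N t - prim (primC N) 1)
          (IccExtend zero_le_one N t) I t :=
        (((hasDerivAt_prim N t).const_add (y - x)).sub_const _).hasDerivWithinAt
      have h2 := h1.congr hval' (hval' t ht)
      rw [IccExtend_of_mem _ _ ht, hN, accel_apply hf hx (hWR x y hx hy)] at h2
      simpa only [IccExtend_of_mem _ _ ht] using h2
    · exact (hsub (add_prim_mem hx (hWR x y hx hy) ht)).2
    · simp only [prim_zero, add_zero]
    -- The fixed point is `y - x` plus a function of mean zero, so its integral over `I` is `y - x`.
    · have h1 : W x y = ContinuousMap.const I (y - x) -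
          (ContinuousMap.const I (prim (primC N) 1) - primC N) := by
        ext t
        rw [hval t]
        simp only [ContinuousMap.sub_apply, ContinuousMap.const_apply]
        change _ = y - x - (prim (primC N) 1 - prim N t)
        abel
      have h2 : prim (W x y) 1 = y - x := by
        rw [h1, ← prim_sub, ← prim_sub, prim_const, prim_const]
        simp
      simp only [h2, add_sub_cancel]
  · intro x hx t
    simp only [hW0 x hx, hprim0, add_zero]
  · have hWc : ContinuousOn (fun q : E × E => W q.1 q.2)
        (Metric.ball p (R / 4) ×ˢ Metric.ball p (R / 4)) := by
      intro q hq
      rw [ContinuousWithinAt, tendsto_iff_norm_sub_tendsto_zero]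
      have hlim : Tendsto (fun q' : E × E =>
          2 * ‖(q'.2 - q'.1) - (q.2 - q.1)‖ + ‖q'.1 - q.1‖)
          (𝓝[Metric.ball p (R / 4) ×ˢ Metric.ball p (R / 4)] q) (𝓝 0) := by
        have : Continuous (fun q' : E × E =>
          2 * ‖(q'.2 - q'.1) - (q.2 - q.1)‖ + ‖q'.1 - q.1‖) := by fun_prop
        have h := this.tendsto q
        simp only [sub_self, norm_zero, mul_zero, add_zero] at h
        exact h.mono_left nhdsWithin_le_nhds
      refine squeeze_zero' (Eventually.of_forall fun _ => norm_nonneg _) ?_ hlim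
      filter_upwards [self_mem_nhdsWithin] with q' hq'
      exact hlip _ hq'.1 _ hq'.2 _ hq.1 _ hq.2
    have hprimC : Continuous (primC : C(I, E) → C(I, E)) :=
      (LipschitzWith.of_dist_le_mul (K := 1) fun w w' => by
        simpa [dist_eq_norm] using norm_primC_sub_le w w').continuous
    -- Joint continuity comes from that of evaluation on `C(I, E) × I`; hence time is projected to
    -- `I`.
    have h1 : ContinuousOn (fun q : E × E × ℝ => (primC (W q.1 q.2.1), projIcc 0 1 zero_le_one q.2.2))
        (Metric.ball p (R / 4) ×ˢ Metric.ball p (R / 4) ×ˢ I) := by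
      refine ContinuousOn.prodMk (hprimC.comp_continuousOn ?_) ?_
      · exact hWc.comp (f := fun q : E × E × ℝ => (q.1, q.2.1)) (by fun_prop)
          fun q hq => ⟨hq.1, hq.2.1⟩
      · exact (continuous_projIcc.comp (by fun_prop)).continuousOn
    have h2 : ContinuousOn (fun q : E × E × ℝ =>
        q.1 + primC (W q.1 q.2.1) (projIcc 0 1 zero_le_one q.2.2))
        (Metric.ball p (R / 4) ×ˢ Metric.ball p (R / 4) ×ˢ I) :=
      continuousOn_fst.add (continuous_eval.comp_continuousOn h1)
    refine h2.congr fun q hq => ?_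
    change _ = q.1 + prim (W q.1 q.2.1) (projIcc 0 1 zero_le_one q.2.2 : I)
    rw [projIcc_of_mem _ hq.2.2]
  · exact fun z hz => (hsub (Metric.ball_subset_ball (by linarith) hz)).2

end BoundaryValueProblem

end GeodesicBVP

/-! ### Connecting geodesics and deformations inside a small open set. -/

namespace AffineConnection

section Connecting

variable {E : Type*} [NormedAddCommGroup E] [NormedSpace ℝ E]
  {M : Type*} [TopologicalSpace M] [ChartedSpace E M]

/-- `c x y` is a geodesic from `x` to `y` which depends continuously on `x, y ∈ U` and is constant
if `x = y`. -/
structure ConnectsBy (B : AffineConnection E M) (U : Set M) (c : M → M → ℝ → M) : Prop where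
  isOpen : IsOpen U
  continuousOn : ContinuousOn (fun q : M × M × ℝ => c q.1 q.2.1 q.2.2) (U ×ˢ U ×ˢ I)
  zero : ∀ x ∈ U, ∀ y ∈ U, c x y 0 = x
  one : ∀ x ∈ U, ∀ y ∈ U, c x y 1 = y
  self : ∀ x ∈ U, ∀ t, c x x t = x
  isGeodesicOn : ∀ x ∈ U, ∀ y ∈ U, ∀ a b : ℝ, a < b →
    B.IsGeodesicOn (fun t => c x y ((t - a) / (b - a))) (Icc a b)

variable {B : AffineConnection E M} {α β : ℝ → M} {a b : ℝ} {U : Set M} {c : M → M → ℝ → M}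

/-- The case `m = a` is included, since `0 / 0 = 0`. -/
theorem sub_div_sub_mem_unitInterval {t m : ℝ} (h : a ≤ t) (h' : t ≤ m) :
    (t - a) / (m - a) ∈ I :=
  ⟨div_nonneg (by linarith) (by linarith), div_le_one_of_le₀ (by linarith) (by linarith)⟩

theorem exists_connectsBy [CompleteSpace E] [IsManifold 𝓘(ℝ, E) ∞ M] (B : AffineConnection E M)
    (p : M) : ∃ (U : Set M) (c : M → M → ℝ → M), p ∈ U ∧ B.ConnectsBy U c := by
  set φ := chartAt E p
  have hφ : φ ∈ IsManifold.maximalAtlas 𝓘(ℝ, E) ∞ M := IsManifold.chart_mem_maximalAtlas p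
  have hp : p ∈ φ.source := mem_chart_source E p
  obtain ⟨r, hr, u, w, hsol, hself, hcont, hsub⟩ :=
    GeodesicBVP.exists_solution φ.open_target (B.smooth φ hφ) (φ.map_source hp)
  set V := Metric.ball (φ p) r
  refine ⟨φ.source ∩ φ ⁻¹' V, fun x y t => φ.symm (u (φ x) (φ y) t),
    ⟨hp, Metric.mem_ball_self hr⟩, φ.isOpen_inter_preimage Metric.isOpen_ball, ?_, ?_, ?_, ?_, ?_⟩
  · have h1 : ContinuousOn (fun q : M × M × ℝ => (φ q.1, φ q.2.1, q.2.2))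
        ((φ.source ∩ φ ⁻¹' V) ×ˢ (φ.source ∩ φ ⁻¹' V) ×ˢ I) := by
      refine ContinuousOn.prodMk (φ.continuousOn.comp continuousOn_fst fun q hq => hq.1.1)
        (ContinuousOn.prodMk (φ.continuousOn.comp (by fun_prop) fun q hq => hq.2.1.1)
          (by fun_prop))
    have h2 := hcont.comp h1 fun q hq => ⟨hq.1.2, hq.2.1.2, hq.2.2⟩
    exact φ.continuousOn_symm.comp h2 fun q hq => (hsol _ hq.1.2 _ hq.2.1.2).2.2.1 _ hq.2.2
  · intro x hx y hy
    rw [(hsol _ hx.2 _ hy.2).2.2.2.1, φ.left_inv hx.1]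
  · intro x hx y hy
    rw [(hsol _ hx.2 _ hy.2).2.2.2.2, φ.left_inv hy.1]
  · intro x hx t
    rw [hself _ hx.2, φ.left_inv hx.1]
  · intro x hx y hy a b hab
    obtain ⟨h1, h2, h3, -, -⟩ := hsol _ hx.2 _ hy.2
    have hmaps : MapsTo (fun t => (t - a) / (b - a)) (Icc a b) I := fun t ht =>
      sub_div_sub_mem_unitInterval ht.1 ht.2
    have hd : ∀ t, HasDerivWithinAt (fun t => (t - a) / (b - a)) (1 / (b - a)) (Icc a b) t :=
      fun t => (((hasDerivAt_id t).sub_const a).div_const (b - a)).hasDerivWithinAt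
    -- An affine change of time multiplies the velocity by `1 / (b - a)` and the acceleration by its
    -- square, in accordance with an equation quadratic in the velocity.
    refine B.isGeodesicOn_symm_comp hφ hab
      (u := fun t => u (φ x) (φ y) ((t - a) / (b - a)))
      (w := fun t => (1 / (b - a)) • w (φ x) (φ y) ((t - a) / (b - a))) ?_ ?_ ?_
    · exact fun t ht => (h1 _ (hmaps ht)).scomp t (hd t) hmaps
    · intro t ht
      have := ((h2 _ (hmaps ht)).scomp t (hd t) hmaps).const_smul (1 / (b - a))
      simp only [map_smul, smul_apply]
      exact this
    · exact fun t ht => h3 _ (hmaps ht)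

/-- Geodesics between points near `x` stay near `x`: `c x x` is constant, and compactness of `I`
makes the continuity uniform in time. -/
theorem ConnectsBy.exists_nhds (hc : B.ConnectsBy U c) {x : M} (hx : x ∈ U) {W : Set M}
    (hW : W ∈ 𝓝 x) :
    ∃ N ⊆ U, IsOpen N ∧ x ∈ N ∧ ∀ y ∈ N, ∀ z ∈ N, ∀ t ∈ I, c y z t ∈ W := by
  have h : ∀ᶠ q : M × M in 𝓝 (x, x), ∀ t ∈ I, q.1 ∈ U → q.2 ∈ U → t ∈ I → c q.1 q.2 t ∈ W := by
    refine isCompact_Icc.eventually_forall_of_forall_eventually fun t ht => ?_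
    have h1 := hc.continuousOn (x, x, t) ⟨hx, hx, ht⟩
    have h2 : ∀ᶠ q : M × M × ℝ in 𝓝 (x, x, t),
        q ∈ U ×ˢ U ×ˢ I → c q.1 q.2.1 q.2.2 ∈ W := by
      rw [← eventually_nhdsWithin_iff]
      refine h1.eventually ?_
      simp only [hc.self x hx]
      exact hW
    have h3 : Tendsto (fun q : (M × M) × ℝ => (q.1.1, q.1.2, q.2)) (𝓝 ((x, x), t))
        (𝓝 (x, x, t)) :=
      Continuous.tendsto (f := fun q : (M × M) × ℝ => (q.1.1, q.1.2, q.2)) (by fun_prop) _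
    filter_upwards [h3.eventually h2] with q hq hq1 hq2 hq3 using hq ⟨hq1, hq2, hq3⟩
  obtain ⟨N₁, N₂, ho₁, hx₁, ho₂, hx₂, hN⟩ := mem_nhds_prod_iff'.1 h
  refine ⟨U ∩ (N₁ ∩ N₂), inter_subset_left, hc.isOpen.inter (ho₁.inter ho₂), ⟨hx, hx₁, hx₂⟩, ?_⟩
  intro y hy z hz t ht
  exact hN (show (y, z) ∈ N₁ ×ˢ N₂ from ⟨hy.2.1, hz.2.2⟩) t ht hy.1 hz.1 ht

/-- `H s`, for `s ∈ [s₀, s₁]`, is a homotopy of piecewise geodesics on `[a, b]`. -/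
structure IsGeodesicHomotopy (B : AffineConnection E M) (H : ℝ → ℝ → M) (s₀ s₁ a b : ℝ) :
    Prop where
  continuousOn : ContinuousOn (fun q : ℝ × ℝ => H q.1 q.2) (Icc s₀ s₁ ×ˢ Icc a b)
  isPiecewiseGeodesicOn : ∀ s ∈ Icc s₀ s₁, B.IsPiecewiseGeodesicOn (H s) a b

namespace IsGeodesicHomotopy

variable {H H₁ H₂ : ℝ → ℝ → M} {s₀ s₁ s₂ d : ℝ}

theorem comp {s₀' s₁' : ℝ} {ρ : ℝ → ℝ} (h : B.IsGeodesicHomotopy H s₀ s₁ a b)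
    (hρ : Continuous ρ) (hm : MapsTo ρ (Icc s₀' s₁') (Icc s₀ s₁)) :
    B.IsGeodesicHomotopy (fun s => H (ρ s)) s₀' s₁' a b :=
  ⟨h.continuousOn.comp (f := fun q : ℝ × ℝ => (ρ q.1, q.2)) (by fun_prop)
    fun _ hq => ⟨hm hq.1, hq.2⟩, fun s hs => h.isPiecewiseGeodesicOn _ (hm hs)⟩

theorem glue_time (h₁ : B.IsGeodesicHomotopy H₁ s₀ s₁ a b)
    (h₂ : B.IsGeodesicHomotopy H₂ s₀ s₁ b d) (hab : a ≤ b) (hbd : b ≤ d)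
    (h : ∀ s ∈ Icc s₀ s₁, H₁ s b = H₂ s b) :
    B.IsGeodesicHomotopy (fun s t => if t ≤ b then H₁ s t else H₂ s t) s₀ s₁ a d := by
  refine ⟨?_, fun s hs => (h₁.isPiecewiseGeodesicOn s hs).ite (h₂.isPiecewiseGeodesicOn s hs)
    (h s hs)⟩
  rw [← Icc_union_Icc_eq_Icc hab hbd, prod_union]
  refine ContinuousOn.union_of_isClosed (h₁.continuousOn.congr fun q hq => if_pos hq.2.2)
    (h₂.continuousOn.congr fun q hq => ?_) (isClosed_Icc.prod isClosed_Icc)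
    (isClosed_Icc.prod isClosed_Icc)
  rcases hq.2.1.eq_or_lt with h' | h'
  · simp [← h', h q.1 hq.1]
  · simp [h'.not_ge]

theorem glue_param (h₁ : B.IsGeodesicHomotopy H₁ s₀ s₁ a b)
    (h₂ : B.IsGeodesicHomotopy H₂ s₁ s₂ a b) (h01 : s₀ ≤ s₁) (h12 : s₁ ≤ s₂)
    (h : ∀ t ∈ Icc a b, H₁ s₁ t = H₂ s₁ t) :
    B.IsGeodesicHomotopy (fun s t => if s ≤ s₁ then H₁ s t else H₂ s t) s₀ s₂ a b := by
  constructor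
  · rw [← Icc_union_Icc_eq_Icc h01 h12, union_prod]
    refine ContinuousOn.union_of_isClosed (h₁.continuousOn.congr fun q hq => if_pos hq.1.2)
      (h₂.continuousOn.congr fun q hq => ?_) (isClosed_Icc.prod isClosed_Icc)
      (isClosed_Icc.prod isClosed_Icc)
    rcases hq.1.1.eq_or_lt with h' | h'
    · simp [← h', h q.2 hq.2]
    · simp [h'.not_ge]
  · intro s hs
    rcases le_or_gt s s₁ with h' | h'
    · simp only [h', if_true]
      exact h₁.isPiecewiseGeodesicOn s ⟨hs.1, h'⟩
    · simp only [h'.not_ge, if_false]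
      exact h₂.isPiecewiseGeodesicOn s ⟨h'.le, hs.2⟩

end IsGeodesicHomotopy

/-- The curve `α` with its part up to time `m` replaced by the geodesic `c (α a) (α m)`. -/
noncomputable def shortcut (c : M → M → ℝ → M) (α : ℝ → M) (a m t : ℝ) : M :=
  if t ≤ m then c (α a) (α m) ((t - a) / (m - a)) else α t

theorem ConnectsBy.shortcut_of_le (hc : B.ConnectsBy U c) (hα : MapsTo α (Icc a b) U) {m t : ℝ}
    (hm : m ∈ Icc a b) (ht : m ≤ t) : shortcut c α a m t = α t := by
  unfold shortcut
  rcases ht.eq_or_lt with rfl | ht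
  · rw [if_pos le_rfl]
    have ha := hα ⟨le_rfl, hm.1.trans hm.2⟩
    rcases hm.1.eq_or_lt with rfl | h
    · exact hc.self _ ha _
    · rw [div_self (sub_pos.2 h).ne']
      exact hc.one _ ha _ (hα hm)
  · rw [if_neg ht.not_ge]

theorem ConnectsBy.shortcut_left (hc : B.ConnectsBy U c) (hα : MapsTo α (Icc a b) U) {m : ℝ}
    (hm : m ∈ Icc a b) : shortcut c α a m a = α a := by
  unfold shortcut
  rw [if_pos hm.1, sub_self, zero_div]
  exact hc.zero _ (hα ⟨le_rfl, hm.1.trans hm.2⟩) _ (hα hm)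

/-- As `m` runs from `a` to `b`, the curve `α` is deformed into the single geodesic `c (α a) (α b)`
with its end points fixed. -/
theorem ConnectsBy.isGeodesicHomotopy_shortcut [IsManifold 𝓘(ℝ, E) ∞ M]
    (hc : B.ConnectsBy U c) (hab : a < b) (h : B.IsPiecewiseGeodesicOn α a b)
    (hα : MapsTo α (Icc a b) U) : B.IsGeodesicHomotopy (shortcut c α a) a b a b := by
  have haU : α a ∈ U := hα ⟨le_rfl, hab.le⟩
  constructor
  · have hS : Icc a b ×ˢ Icc a b = (Icc a b ×ˢ Icc a b ∩ {q : ℝ × ℝ | q.2 ≤ q.1}) ∪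
        (Icc a b ×ˢ Icc a b ∩ {q : ℝ × ℝ | q.1 ≤ q.2}) := by
      rw [← inter_union_distrib_left, left_eq_inter]
      exact fun q _ => le_total q.2 q.1
    have hcl : IsClosed (Icc a b ×ˢ Icc a b) := isClosed_Icc.prod isClosed_Icc
    rw [hS]
    refine ContinuousOn.union_of_isClosed ?_ ?_
      (hcl.inter (isClosed_le continuous_snd continuous_fst))
      (hcl.inter (isClosed_le continuous_fst continuous_snd))
    · have hg : ContinuousOn (fun q : ℝ × ℝ => c (α a) (α q.1) ((q.2 - a) / (q.1 - a)))
          (Icc a b ×ˢ Icc a b ∩ {q : ℝ × ℝ | q.2 ≤ q.1}) := by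
        have hα1 : ContinuousOn (fun q : ℝ × ℝ => α q.1)
            (Icc a b ×ˢ Icc a b ∩ {q : ℝ × ℝ | q.2 ≤ q.1}) :=
          h.1.comp continuousOn_fst fun q hq => hq.1.1
        rintro ⟨m, t⟩ ⟨⟨hm, ht⟩, htm⟩
        simp only [mem_ofPred_eq] at hm ht htm
        rcases hm.1.eq_or_lt with rfl | ham
        · obtain rfl : t = a := le_antisymm htm ht.1
          -- At the corner `m = t = a` the ratio `(t - a) / (m - a)` has no limit; continuity holds
          -- because the whole geodesic from `α a` to a nearby `α m` stays in `W`.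
          intro W hW
          simp only [sub_self, div_zero, hc.zero _ haU _ haU] at hW
          obtain ⟨N, -, hNo, haN, hN⟩ := hc.exists_nhds haU hW
          have h1 := hα1 (t, t) ⟨⟨hm, hm⟩, le_refl t⟩ (hNo.mem_nhds haN)
          rw [mem_map]
          filter_upwards [h1, self_mem_nhdsWithin] with q hq1 hq2
          exact hN _ haN _ hq1 _ (sub_div_sub_mem_unitInterval hq2.1.2.1 hq2.2)
        · have h1 : ContinuousWithinAt
              (fun q : ℝ × ℝ => (α a, α q.1, (q.2 - a) / (q.1 - a)))
              (Icc a b ×ˢ Icc a b ∩ {q : ℝ × ℝ | q.2 ≤ q.1}) (m, t) := by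
            refine continuousWithinAt_const.prodMk
              ((hα1 (m, t) ⟨⟨hm, ht⟩, htm⟩).prodMk (ContinuousWithinAt.div ?_ ?_ ?_))
            · exact (by fun_prop : Continuous fun q : ℝ × ℝ => q.2 - a).continuousWithinAt
            · exact (by fun_prop : Continuous fun q : ℝ × ℝ => q.1 - a).continuousWithinAt
            · exact (sub_pos.2 ham).ne'
          exact ContinuousWithinAt.comp (x := (m, t))
            (g := fun r : M × M × ℝ => c r.1 r.2.1 r.2.2) (t := U ×ˢ U ×ˢ I)
            (hc.continuousOn (α a, α m, (t - a) / (m - a))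
              ⟨haU, hα hm, sub_div_sub_mem_unitInterval ht.1 htm⟩) h1
            fun q hq => ⟨haU, hα hq.1.1, sub_div_sub_mem_unitInterval hq.1.2.1 hq.2⟩
      exact hg.congr fun q hq => if_pos hq.2
    · exact (h.1.comp continuousOn_snd fun q hq => hq.1.2).congr fun q hq =>
        hc.shortcut_of_le hα hq.1.1 hq.2
  · intro m hm
    rcases hm.1.eq_or_lt with rfl | ham
    · exact h.congr fun t ht => (hc.shortcut_of_le hα hm ht.1).symm
    · refine ((hc.isGeodesicOn _ haU _ (hα hm) a m ham).isPiecewiseGeodesicOn ham.le).ite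
        (h.mono ham.le hm.2 le_rfl) ?_
      simp only [div_self (sub_pos.2 ham).ne']
      exact hc.one _ haU _ (hα hm)

theorem ConnectsBy.isGeodesicHomotopy_move (hc : B.ConnectsBy U c) (hab : a < b) {p q : ℝ → M}
    (hp : Continuous p) (hq : Continuous q) (hpU : ∀ s, p s ∈ U) (hqU : ∀ s, q s ∈ U)
    (s₀ s₁ : ℝ) :
    B.IsGeodesicHomotopy (fun s t => c (p s) (q s) ((t - a) / (b - a))) s₀ s₁ a b := by
  refine ⟨?_, fun s _ =>
    (hc.isGeodesicOn _ (hpU s) _ (hqU s) a b hab).isPiecewiseGeodesicOn hab.le⟩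
  exact hc.continuousOn.comp
    (f := fun r : ℝ × ℝ => (p r.1, q r.1, (r.2 - a) / (b - a))) (by fun_prop)
    fun r hr => ⟨hpU _, hqU _, sub_div_sub_mem_unitInterval hr.2.1 hr.2.2⟩

/-- `α` can be deformed into `β` through piecewise geodesics on `[a, b]` in such a way that the
end points follow `p` and `q`. -/
def GeodesicallyHomotopic (B : AffineConnection E M) (a b : ℝ) (α β : ℝ → M)
    (p : Path (α a) (β a)) (q : Path (α b) (β b)) : Prop :=
  ∃ H : ℝ → ℝ → M, B.IsGeodesicHomotopy H (-1) 2 a b ∧ (∀ t ∈ Icc a b, H (-1) t = α t) ∧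
    (∀ t ∈ Icc a b, H 2 t = β t) ∧ ∀ s ∈ Icc (-1 : ℝ) 2, H s a = p.extend s ∧ H s b = q.extend s

/-- Both deformations move the common end point along the same `q` with the same parameter, so they
fit together at every stage. -/
theorem GeodesicallyHomotopic.glue {d : ℝ} {p : Path (α a) (β a)} {q : Path (α b) (β b)}
    {r : Path (α d) (β d)} (hab : a ≤ b) (hbd : b < d) (h₁ : B.GeodesicallyHomotopic a b α β p q)
    (h₂ : B.GeodesicallyHomotopic b d α β q r) : B.GeodesicallyHomotopic a d α β p r := by
  obtain ⟨H₁, hH₁, h10, h11, h1e⟩ := h₁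
  obtain ⟨H₂, hH₂, h20, h21, h2e⟩ := h₂
  refine ⟨_, hH₁.glue_time hH₂ hab hbd.le fun s hs => (h1e s hs).2.trans (h2e s hs).1.symm,
    fun t ht => ?_, fun t ht => ?_, fun s hs => ⟨?_, ?_⟩⟩
  · split_ifs with h
    · exact h10 t ⟨ht.1, h⟩
    · exact h20 t ⟨(not_le.1 h).le, ht.2⟩
  · split_ifs with h
    · exact h11 t ⟨ht.1, h⟩
    · exact h21 t ⟨(not_le.1 h).le, ht.2⟩
  · simp only [hab, if_true]
    exact (h1e s hs).1
  · simp only [hbd.not_ge, if_false]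
    exact (h2e s hs).2

/-- On `[-1, 0]` the curve `α` is shortened to a geodesic, on `[0, 1]` that geodesic follows `p` and
`q`, and on `[1, 2]` the shortening of `β` is run backwards. The end points rest in the outer
stages, where `Path.extend` is constant. -/
theorem ConnectsBy.geodesicallyHomotopic [IsManifold 𝓘(ℝ, E) ∞ M] (hc : B.ConnectsBy U c)
    (hab : a < b) (h₁ : B.IsPiecewiseGeodesicOn α a b) (h₂ : B.IsPiecewiseGeodesicOn β a b)
    (hα : MapsTo α (Icc a b) U) (hβ : MapsTo β (Icc a b) U) (p : Path (α a) (β a))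
    (q : Path (α b) (β b)) (hp : ∀ s, p s ∈ U) (hq : ∀ s, q s ∈ U) :
    B.GeodesicallyHomotopic a b α β p q := by
  have hK₁ := (hc.isGeodesicHomotopy_shortcut hab h₁ hα).comp (s₀' := -1) (s₁' := 0)
    (ρ := fun s => a + (s + 1) * (b - a)) (by fun_prop) fun s hs =>
      ⟨by nlinarith [hs.1, hs.2], by nlinarith [hs.1, hs.2]⟩
  have hK₂ := (hc.isGeodesicHomotopy_shortcut hab h₂ hβ).comp (s₀' := 1) (s₁' := 2)
    (ρ := fun s => a + (2 - s) * (b - a)) (by fun_prop) fun s hs =>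
      ⟨by nlinarith [hs.1, hs.2], by nlinarith [hs.1, hs.2]⟩
  have hmv := hc.isGeodesicHomotopy_move hab p.continuous_extend q.continuous_extend
    (fun s => hp _) (fun s => hq _) 0 1
  have ha : a ∈ Icc a b := ⟨le_rfl, hab.le⟩
  have hb : b ∈ Icc a b := ⟨hab.le, le_rfl⟩
  have hba : (b - a) ≠ 0 := (sub_pos.2 hab).ne'
  have hcomb := (hK₁.glue_param hmv (by norm_num) (by norm_num) ?_).glue_param hK₂
    (by norm_num) (by norm_num) ?_
  · refine ⟨_, hcomb, fun t ht => ?_, fun t ht => ?_, fun s hs => ?_⟩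
    · norm_num
      exact hc.shortcut_of_le hα ha ht.1
    · norm_num
      exact hc.shortcut_of_le hβ ha ht.1
    · split_ifs with hs1 hs0
      · have hm : a + (s + 1) * (b - a) ∈ Icc a b :=
          ⟨by nlinarith [hs.1], by nlinarith [hs.1]⟩
        rw [hc.shortcut_left hα hm, hc.shortcut_of_le hα hm hm.2, p.extend_of_le_zero hs0,
          q.extend_of_le_zero hs0]
        exact ⟨rfl, rfl⟩
      · rw [sub_self, zero_div, div_self hba]
        exact ⟨hc.zero _ (hp _) _ (hq _), hc.one _ (hp _) _ (hq _)⟩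
      · have hs1' : 1 ≤ s := (not_le.1 hs1).le
        have hm : a + (2 - s) * (b - a) ∈ Icc a b :=
          ⟨by nlinarith [hs.2], by nlinarith [hs.2]⟩
        rw [hc.shortcut_left hβ hm, hc.shortcut_of_le hβ hm hm.2, p.extend_of_one_le hs1',
          q.extend_of_one_le hs1']
        exact ⟨rfl, rfl⟩
  · intro t ht
    simp [shortcut, ht.2]
  · intro t ht
    norm_num [shortcut, ht.2]

end Connecting

end AffineConnection

/-! ### From local deformations to homotopies. -/

namespace AffineConnection

section Global

/-- A transitive relation on the points of an interval which holds for all sufficiently close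
points holds for the end points. -/
theorem rel_of_locally {Q : ℝ → ℝ → Prop} {a b : ℝ} (hab : a < b)
    (htrans : ∀ u v w, a ≤ u → u < v → v < w → w ≤ b → Q u v → Q v w → Q u w)
    (hloc : ∀ t ∈ Icc a b, ∃ J ∈ 𝓝 t, ∀ u v, u < v → Icc u v ⊆ J → Q u v) : Q a b := by
  choose! J hJ hQ using hloc
  obtain ⟨t, h0, hmono, ⟨m, hm⟩, hsub⟩ := exists_monotone_Icc_subset_open_cover_Icc hab.le
    (c := fun i : Icc a b => (Subtype.val : Icc a b → ℝ) ⁻¹' interior (J i))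
    (fun i => isOpen_interior.preimage continuous_subtype_val)
    fun i _ => mem_iUnion.2 ⟨i, mem_interior_iff_mem_nhds.2 (hJ i i.2)⟩
  -- The subdivision is only monotone and may repeat points; `Q` is available for strict steps
  -- alone, and trivial steps are skipped below.
  have hstep : ∀ n, (t n : ℝ) < t (n + 1) → Q (t n) (t (n + 1)) := by
    intro n hn
    obtain ⟨i, hi⟩ := hsub n
    refine hQ i i.2 _ _ hn fun s hs => ?_
    have hs' : s ∈ Icc a b := ⟨(t n).2.1.trans hs.1, hs.2.trans (t (n + 1)).2.2⟩
    exact interior_subset (hi (show (⟨s, hs'⟩ : Icc a b) ∈ _ from ⟨hs.1, hs.2⟩))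
  have key : ∀ n, a < t n → Q a (t n) := by
    intro n
    induction n with
    | zero => intro h; exact absurd h (by rw [h0]; exact lt_irrefl a)
    | succ n ih =>
      intro h
      have hle : (t n : ℝ) ≤ t (n + 1) := hmono n.le_succ
      rcases hle.eq_or_lt with h1 | h1
      · rw [← h1] at h ⊢
        exact ih h
      · rcases (t n).2.1.eq_or_lt with h2 | h2
        · have := hstep n h1
          rwa [← h2] at this
        · exact htrans a (t n) _ le_rfl h2 h1 (t (n + 1)).2.2 (ih h2) (hstep n h1)
  have := key m (by rw [hm m le_rfl]; exact hab)
  rwa [hm m le_rfl] at this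

variable {E : Type*} [NormedAddCommGroup E] [NormedSpace ℝ E] [CompleteSpace E]
  {M : Type*} [TopologicalSpace M] [ChartedSpace E M] [IsManifold 𝓘(ℝ, E) ∞ M]

/-- A curve can be approximated by piecewise geodesics with the same end points. -/
theorem exists_isPiecewiseGeodesicOn_mem (B : AffineConnection E M) {γ : ℝ → M}
    (hγ : Continuous γ) {O : Set (ℝ × M)} (hO : IsOpen O) {a b : ℝ} (hab : a < b)
    (hγO : ∀ t ∈ Icc a b, (t, γ t) ∈ O) :
    ∃ β : ℝ → M, B.IsPiecewiseGeodesicOn β a b ∧ β a = γ a ∧ β b = γ b ∧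
      ∀ t ∈ Icc a b, (t, β t) ∈ O := by
  refine rel_of_locally (Q := fun a b => ∃ β : ℝ → M, B.IsPiecewiseGeodesicOn β a b ∧ β a = γ a ∧
    β b = γ b ∧ ∀ t ∈ Icc a b, (t, β t) ∈ O) hab ?_ ?_
  · rintro u v w - huv hvw - ⟨β₁, h₁, hu₁, hv₁, hm₁⟩ ⟨β₂, h₂, hv₂, hw₂, hm₂⟩
    refine ⟨_, h₁.ite h₂ (hv₁.trans hv₂.symm), ?_, ?_, fun t ht => ?_⟩
    · simp [huv.le, hu₁]
    · simp [hvw.not_ge, hw₂]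
    · split_ifs with h
      · exact hm₁ t ⟨ht.1, h⟩
      · exact hm₂ t ⟨(not_le.1 h).le, ht.2⟩
  · intro t ht
    obtain ⟨S, W, hS, hW, htS, htW, hSW⟩ := isOpen_prod_iff.1 hO t (γ t) (hγO t ht)
    obtain ⟨U, c, hU, hc⟩ := B.exists_connectsBy (γ t)
    obtain ⟨N, hNU, hNo, htN, hN⟩ := hc.exists_nhds hU (hW.mem_nhds htW)
    refine ⟨S ∩ γ ⁻¹' N, inter_mem (hS.mem_nhds htS) (hγ.continuousAt (hNo.mem_nhds htN)),
      fun u v huv hsub => ?_⟩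
    have hu : γ u ∈ N := (hsub ⟨le_rfl, huv.le⟩).2
    have hv : γ v ∈ N := (hsub ⟨huv.le, le_rfl⟩).2
    refine ⟨_, (hc.isGeodesicOn _ (hNU hu) _ (hNU hv) u v huv).isPiecewiseGeodesicOn huv.le,
      ?_, ?_, fun s hs => ?_⟩
    · simp only [sub_self, zero_div]
      exact hc.zero _ (hNU hu) _ (hNU hv)
    · simp only [div_self (sub_pos.2 huv).ne']
      exact hc.one _ (hNU hu) _ (hNU hv)
    · exact hSW ⟨(hsub hs).1, hN _ hu _ hv _ (sub_div_sub_mem_unitInterval hs.1 hs.2)⟩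

/-- All piecewise geodesics sufficiently close to a given curve can be deformed into each other
through piecewise geodesics, with prescribed motion of the end points. -/
theorem exists_nhds_geodesicallyHomotopic (B : AffineConnection E M) {γ : ℝ → M}
    (hγ : Continuous γ) {a b : ℝ} (hab : a < b) :
    ∃ O : Set (ℝ × M), IsOpen O ∧ (∀ t ∈ Icc a b, (t, γ t) ∈ O) ∧
      ∃ P Q : Set M, IsOpen P ∧ IsOpen Q ∧ γ a ∈ P ∧ γ b ∈ Q ∧
        ∀ α β : ℝ → M, B.IsPiecewiseGeodesicOn α a b → B.IsPiecewiseGeodesicOn β a b →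
          (∀ t ∈ Icc a b, (t, α t) ∈ O) → (∀ t ∈ Icc a b, (t, β t) ∈ O) →
          ∀ (p : Path (α a) (β a)) (q : Path (α b) (β b)), (∀ s, p s ∈ P) → (∀ s, q s ∈ Q) →
            B.GeodesicallyHomotopic a b α β p q := by
  refine rel_of_locally (Q := fun a b => ∃ O : Set (ℝ × M), IsOpen O ∧
      (∀ t ∈ Icc a b, (t, γ t) ∈ O) ∧
      ∃ P Q : Set M, IsOpen P ∧ IsOpen Q ∧ γ a ∈ P ∧ γ b ∈ Q ∧
        ∀ α β : ℝ → M, B.IsPiecewiseGeodesicOn α a b → B.IsPiecewiseGeodesicOn β a b →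
          (∀ t ∈ Icc a b, (t, α t) ∈ O) → (∀ t ∈ Icc a b, (t, β t) ∈ O) →
          ∀ (p : Path (α a) (β a)) (q : Path (α b) (β b)), (∀ s, p s ∈ P) → (∀ s, q s ∈ Q) →
            B.GeodesicallyHomotopic a b α β p q) hab ?_ ?_
  · rintro u v w - huv hvw - ⟨O₁, hO₁, hγ₁, P, Q, hP, hQ, huP, hvQ, h₁⟩
      ⟨O₂, hO₂, hγ₂, P', Q', hP', hQ', hvP', hwQ', h₂⟩
    obtain ⟨U, c, hU, hc⟩ := B.exists_connectsBy (γ v)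
    obtain ⟨N, hNU, hNo, hvN, hN⟩ :=
      hc.exists_nhds hU ((hQ.inter hP').mem_nhds ⟨hvQ, hvP'⟩)
    -- The open way to demand `O₁` for times `≤ v`, `O₂` for times `≥ v`, and `N` at time `v`.
    refine ⟨(Prod.fst ⁻¹' Ioi v ∪ O₁) ∩ (Prod.fst ⁻¹' Iio v ∪ O₂) ∩
      (Prod.fst ⁻¹' {v}ᶜ ∪ Prod.snd ⁻¹' N), ?_, ?_, P, Q', hP, hQ', huP, hwQ', ?_⟩
    · exact (((isOpen_Ioi.preimage continuous_fst).union hO₁).inter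
        ((isOpen_Iio.preimage continuous_fst).union hO₂)).inter
        ((isOpen_compl_singleton.preimage continuous_fst).union (hNo.preimage continuous_snd))
    · intro t ht
      refine ⟨⟨?_, ?_⟩, ?_⟩
      · rcases le_or_gt t v with h | h
        · exact Or.inr (hγ₁ t ⟨ht.1, h⟩)
        · exact Or.inl h
      · rcases le_or_gt v t with h | h
        · exact Or.inr (hγ₂ t ⟨h, ht.2⟩)
        · exact Or.inl h
      · by_cases h : t = v
        · exact Or.inr (by rw [h]; exact hvN)
        · exact Or.inl h
    · intro α β hα hβ hαO hβO p q hp hq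
      have hl : ∀ δ : ℝ → M, (∀ t ∈ Icc u w, (t, δ t) ∈ (Prod.fst ⁻¹' Ioi v ∪ O₁) ∩
          (Prod.fst ⁻¹' Iio v ∪ O₂) ∩ (Prod.fst ⁻¹' {v}ᶜ ∪ Prod.snd ⁻¹' N)) →
          (∀ t ∈ Icc u v, (t, δ t) ∈ O₁) ∧ (∀ t ∈ Icc v w, (t, δ t) ∈ O₂) ∧ δ v ∈ N := by
        intro δ hδ
        refine ⟨fun t ht => ?_, fun t ht => ?_, ?_⟩
        · exact (hδ t ⟨ht.1, ht.2.trans hvw.le⟩).1.1.resolve_left ht.2.not_gt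
        · exact (hδ t ⟨huv.le.trans ht.1, ht.2⟩).1.2.resolve_left ht.1.not_gt
        · exact (hδ v ⟨huv.le, hvw.le⟩).2.resolve_left fun h => h rfl
      obtain ⟨hα₁, hα₂, hαv⟩ := hl α hαO
      obtain ⟨hβ₁, hβ₂, hβv⟩ := hl β hβO
      -- The junction moves along the short geodesic from `α v` to `β v`. By the choice of `N` it
      -- stays in `Q ∩ P'`, so it is an admissible end point motion for both halves.
      let r : Path (α v) (β v) :=
        { toFun := fun s => c (α v) (β v) s
          continuous_toFun := hc.continuousOn.comp_continuous
            (f := fun s : I => (α v, β v, (s : ℝ))) (by fun_prop)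
            fun s => ⟨hNU hαv, hNU hβv, s.2⟩
          source' := hc.zero _ (hNU hαv) _ (hNU hβv)
          target' := hc.one _ (hNU hαv) _ (hNU hβv) }
      have hr : ∀ s, r s ∈ Q ∩ P' := fun s => hN _ hαv _ hβv s s.2
      exact (h₁ α β (hα.mono le_rfl huv.le hvw.le) (hβ.mono le_rfl huv.le hvw.le) hα₁ hβ₁ p r hp
        fun s => (hr s).1).glue huv.le hvw
        (h₂ α β (hα.mono huv.le hvw.le le_rfl) (hβ.mono huv.le hvw.le le_rfl) hα₂ hβ₂ r q
          (fun s => (hr s).2) hq)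
  · intro t _
    obtain ⟨U, c, hU, hc⟩ := B.exists_connectsBy (γ t)
    refine ⟨γ ⁻¹' U, hγ.continuousAt (hc.isOpen.mem_nhds hU), fun u v huv hsub =>
      ⟨Prod.snd ⁻¹' U, hc.isOpen.preimage continuous_snd, fun s hs => hsub hs, U, U, hc.isOpen,
        hc.isOpen, hsub ⟨le_rfl, huv.le⟩, hsub ⟨huv.le, le_rfl⟩, ?_⟩⟩
    intro α β hα hβ hαO hβO p q hp hq
    exact hc.geodesicallyHomotopic huv hα hβ hαO hβO p q hp hq

/-- `α` and `β` are homotopic through piecewise geodesics. -/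
def GeodesicHomotopic (B : AffineConnection E M) {x y : M} (α β : Path x y) : Prop :=
  ∃ H : Path.Homotopy α β, ∀ s : I, B.IsPiecewiseGeodesic (H.eval s)

variable {B : AffineConnection E M} {x y : M} {α β δ : Path x y}

omit [CompleteSpace E] [IsManifold 𝓘(ℝ, E) ∞ M] in
theorem GeodesicHomotopic.trans (h₁ : B.GeodesicHomotopic α β) (h₂ : B.GeodesicHomotopic β δ) :
    B.GeodesicHomotopic α δ := by
  obtain ⟨F, hF⟩ := h₁
  obtain ⟨G, hG⟩ := h₂
  refine ⟨F.trans G, fun s => ?_⟩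
  by_cases hs : (s : ℝ) ≤ 1 / 2
  · have : (F.trans G).eval s =
        F.eval ⟨2 * s, (unitInterval.mul_pos_mem_iff zero_lt_two).2 ⟨s.2.1, hs⟩⟩ := by
      ext t
      exact (Path.Homotopy.trans_apply F G (s, t)).trans (dif_pos hs)
    rw [this]
    exact hF _
  · have : (F.trans G).eval s =
        G.eval ⟨2 * s - 1, unitInterval.two_mul_sub_one_mem_iff.2 ⟨(not_le.1 hs).le, s.2.2⟩⟩ := by
      ext t
      exact (Path.Homotopy.trans_apply F G (s, t)).trans (dif_neg hs)
    rw [this]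
    exact hG _

omit [CompleteSpace E] [IsManifold 𝓘(ℝ, E) ∞ M] in
theorem GeodesicallyHomotopic.geodesicHomotopic {p : Path (α.extend 0) (β.extend 0)}
    {q : Path (α.extend 1) (β.extend 1)} (hp : ∀ s, p s = x) (hq : ∀ s, q s = y)
    (h : B.GeodesicallyHomotopic 0 1 α.extend β.extend p q) : B.GeodesicHomotopic α β := by
  obtain ⟨H, hH, h0, h1, he⟩ := h
  -- `s ↦ 3 * s - 1` maps `I` onto the parameter interval `[-1, 2]`.
  have hmem : ∀ s : I, 3 * (s : ℝ) - 1 ∈ Icc (-1 : ℝ) 2 := fun s =>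
    ⟨by linarith [s.2.1], by linarith [s.2.2]⟩
  have hz : ∀ s : I, H (3 * s - 1) 0 = x := fun s =>
    (he _ (hmem s)).1.trans (hp _)
  have ho : ∀ s : I, H (3 * s - 1) 1 = y := fun s =>
    (he _ (hmem s)).2.trans (hq _)
  let F : Path.Homotopy α β :=
    { toFun := fun r => H (3 * r.1 - 1) r.2
      continuous_toFun := hH.continuousOn.comp_continuous
        (f := fun r : I × I => (3 * (r.1 : ℝ) - 1, (r.2 : ℝ))) (by fun_prop)
        fun r => ⟨hmem r.1, r.2.2⟩
      map_zero_left := fun t => by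
        simp [h0 t t.2]
      map_one_left := fun t => by
        norm_num [h1 t t.2]
      prop' := by
        rintro s t (rfl | rfl)
        · simpa using hz s
        · simpa using ho s }
  refine ⟨F, fun s => (hH.isPiecewiseGeodesicOn _ (hmem s)).congr fun t ht => ?_⟩
  rw [Path.extend_apply _ ht]
  rfl

theorem exists_nhds_geodesicHomotopic (B : AffineConnection E M) (γ : Path x y) :
    ∃ O : Set (ℝ × M), IsOpen O ∧ (∀ t ∈ I, (t, γ.extend t) ∈ O) ∧
      ∀ α β : Path x y, B.IsPiecewiseGeodesic α → B.IsPiecewiseGeodesic β →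
        (∀ t ∈ I, (t, α.extend t) ∈ O) → (∀ t ∈ I, (t, β.extend t) ∈ O) →
        B.GeodesicHomotopic α β := by
  obtain ⟨O, hO, hγO, P, Q, -, -, hx, hy, h⟩ :=
    B.exists_nhds_geodesicallyHomotopic γ.continuous_extend zero_lt_one
  rw [γ.extend_zero] at hx
  rw [γ.extend_one] at hy
  refine ⟨O, hO, hγO, fun α β hα hβ hαO hβO => ?_⟩
  exact (h _ _ hα hβ hαO hβO ((Path.refl x).cast α.extend_zero β.extend_zero)
    ((Path.refl y).cast α.extend_one β.extend_one) (fun _ => hx) (fun _ => hy)).geodesicHomotopic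
    (fun _ => rfl) (fun _ => rfl)

theorem exists_isPiecewiseGeodesic_mem (B : AffineConnection E M) (γ : Path x y)
    {O : Set (ℝ × M)} (hO : IsOpen O) (hγO : ∀ t ∈ I, (t, γ.extend t) ∈ O) :
    ∃ β : Path x y, B.IsPiecewiseGeodesic β ∧ ∀ t ∈ I, (t, β.extend t) ∈ O := by
  obtain ⟨β, hβ, h0, h1, hβO⟩ :=
    B.exists_isPiecewiseGeodesicOn_mem γ.continuous_extend hO zero_lt_one hγO
  let b : Path x y :=
    { toFun := fun t => β t
      continuous_toFun := hβ.1.domRestrict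
      source' := h0.trans γ.extend_zero
      target' := h1.trans γ.extend_one }
  have hb : EqOn β b.extend I := fun t ht => (Path.extend_apply b ht).symm
  exact ⟨b, hβ.congr hb, fun t ht => hb ht ▸ hβO t ht⟩

/-- Homotopic piecewise geodesics are homotopic through piecewise geodesics. -/
theorem geodesicHomotopic_of_homotopic (hα : B.IsPiecewiseGeodesic α)
    (hβ : B.IsPiecewiseGeodesic β) (h : α.Homotopic β) : B.GeodesicHomotopic α β := by
  obtain ⟨H⟩ := h
  have hnear : ∀ {O : Set (ℝ × M)}, IsOpen O → ∀ s : I, (∀ t ∈ I, (t, (H.eval s).extend t) ∈ O) →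
      ∀ᶠ s' in 𝓝 s, ∀ t ∈ I, (t, (H.eval s').extend t) ∈ O := by
    intro O hO s hs
    refine isCompact_Icc.eventually_forall_of_forall_eventually fun t ht => ?_
    have hc : Continuous fun r : I × ℝ => (r.2, (H.eval r.1).extend r.2) :=
      continuous_snd.prodMk (H.continuous.comp
        (continuous_fst.prodMk (continuous_projIcc.comp continuous_snd)))
    exact hc.continuousAt.eventually (hO.mem_nhds (hs t ht))
  -- The intermediate curves `H.eval s` need not be piecewise geodesics, so membership is a
  -- condition on all piecewise geodesics close to them.
  let A : Set I := {s | ∃ O : Set (ℝ × M), IsOpen O ∧ (∀ t ∈ I, (t, (H.eval s).extend t) ∈ O) ∧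
    ∀ δ : Path x y, B.IsPiecewiseGeodesic δ → (∀ t ∈ I, (t, δ.extend t) ∈ O) →
      B.GeodesicHomotopic α δ}
  have hopen : IsOpen A := by
    rw [isOpen_iff_mem_nhds]
    rintro s ⟨O, hO, hs, hOα⟩
    filter_upwards [hnear hO s hs] with s' hs' using ⟨O, hO, hs', hOα⟩
  have hclosed : IsClosed A := by
    rw [← isOpen_compl_iff, isOpen_iff_mem_nhds]
    intro s hsA
    obtain ⟨O, hO, hs, hOO⟩ := B.exists_nhds_geodesicHomotopic (H.eval s)
    filter_upwards [hnear hO s hs] with s' hs'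
    rintro ⟨O', hO', hs'', hOα⟩
    -- A piecewise geodesic `δ` near `H.eval s'` lies in both neighbourhoods: it is linked to `α`
    -- through `O'` and to every piecewise geodesic in `O` through the local result, which would put
    -- `s` in `A`.
    obtain ⟨δ, hδ, hδO⟩ := B.exists_isPiecewiseGeodesic_mem (H.eval s') (hO.inter hO')
      fun t ht => ⟨hs' t ht, hs'' t ht⟩
    have hαδ := hOα δ hδ fun t ht => (hδO t ht).2
    exact hsA ⟨O, hO, hs, fun ε hε hεO =>
      hαδ.trans (hOO δ ε hδ hε (fun t ht => (hδO t ht).1) hεO)⟩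
  have h0 : (0 : I) ∈ A := by
    obtain ⟨O, hO, hs, hOO⟩ := B.exists_nhds_geodesicHomotopic α
    exact ⟨O, hO, by simpa only [H.eval_zero] using hs, fun δ hδ hδO => hOO α δ hα hδ hs hδO⟩
  have hA : A = univ := IsClopen.eq_univ ⟨hclosed, hopen⟩ ⟨0, h0⟩
  obtain ⟨O, -, hs, hOα⟩ : (1 : I) ∈ A := hA ▸ mem_univ _
  exact hOα β hβ (by simpa only [H.eval_one] using hs)

/-- `α ≃ α · (β⁻¹ · β) ≃ (α · β⁻¹) · β ≃ β`. This reduces the simply connected case to the case of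
homotopic curves. -/
theorem homotopic_of_trans_symm {M : Type*} [TopologicalSpace M] {x y : M} {α β : Path x y}
    (h : (α.trans β.symm).Homotopic (Path.refl x)) : α.Homotopic β := by
  have h1 : ((α.trans β.symm).trans β).Homotopic ((Path.refl x).trans β) :=
    h.hcomp (Path.Homotopic.refl β)
  have h2 : (α.trans (β.symm.trans β)).Homotopic (α.trans (Path.refl y)) :=
    (Path.Homotopic.refl α).hcomp ⟨(Path.Homotopy.reflSymmTrans β).symm⟩
  exact (Path.Homotopic.symm ⟨Path.Homotopy.transRefl α⟩).trans
    (h2.symm.trans ((Path.Homotopic.symm ⟨Path.Homotopy.transAssoc α β.symm β⟩).trans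
      (h1.trans ⟨Path.Homotopy.reflTrans β⟩)))

end Global

end AffineConnection

theorem mainTheorem9 {E : Type*} [NormedAddCommGroup E] [NormedSpace ℝ E] [CompleteSpace E]
    {M : Type*} [TopologicalSpace M] [ChartedSpace E M] [IsManifold 𝓘(ℝ, E) ∞ M]
    (B : AffineConnection E M) :
    (∀ (x y : M) (α₀ α₁ : Path x y), B.IsPiecewiseGeodesic α₀ → B.IsPiecewiseGeodesic α₁ →
      α₀.Homotopic α₁ →
        ∃ H : Path.Homotopy α₀ α₁, ∀ s : I, B.IsPiecewiseGeodesic (H.eval s)) ∧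
    ((∀ (x : M) (p : Path x x), p.Homotopic (Path.refl x)) →
      ∀ (x y : M) (α₀ α₁ : Path x y), B.IsPiecewiseGeodesic α₀ → B.IsPiecewiseGeodesic α₁ →
        ∃ H : Path.Homotopy α₀ α₁, ∀ s : I, B.IsPiecewiseGeodesic (H.eval s)) :=
  ⟨fun _ _ _ _ h₀ h₁ h => AffineConnection.geodesicHomotopic_of_homotopic h₀ h₁ h,
    fun hM x _ _ _ h₀ h₁ => AffineConnection.geodesicHomotopic_of_homotopic h₀ h₁
      (AffineConnection.homotopic_of_trans_symm (hM x _))⟩
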